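/- By a circle we mean a closed disk in the plane $\mathbb{R}^2$ with a radius $\ge 0$ (radius $0$ gives a point); $Circ(x)$ denotes the boundary of the circle $x$. On a finite set $X$ of circles let $ch_c(Y)=\{x\in X : x\subseteq \mathrm{conv}(\bigcup_{y\in Y}y)\}$ for $Y\subseteq X$. For distinct $a,b,c\in X$ and $d\in X$, the implication $abc\to d$ is tight if $d\in ch_c(\{a,b,c\})$, but $d$ belongs to none of $ch_c(\{a,b\})$, $ch_c(\{a,c\})$, $ch_c(\{b,c\})$. For a list of points on $Circ(d)$, to be in counterclockwise order means that, walking counterclockwise from the first one, one meets them in the listed order before a full turn is completed, where consecutive points of the list may coincide. **Theorem (Point Order Theorem).** Let $abc\to d$ be a tight implication. Let $A_0,B_0,C_0$ be the points where the rays from the centre of $d$ through the centres of $a,b,c$ meet $Circ(d)$, and suppose that $B_0,A_0,C_0$ are in counterclockwise order on $Circ(d)$. For $x\in\{a,b,c\}$ consider the points where the outer common tangent lines of $d$ and $x$ (those with $d$ and $x$ on the same side) touch $Circ(d)$; label them $A_1,A_2$ for $x=a$, $B_1,B_2$ for $x=b$ and $C_1,C_2$ for $x=c$, so that the triples $A_1,A_0,A_2$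 and $B_1,B_0,B_2$ and $C_2,C_0,C_1$ are in counterclockwise order. Then the counterclockwise order of these points on $Circ(d)$, beginning at $B_1$, is $$B_1,\ C_1,\ A_1,\ B_2,\ C_2,\ A_2 .$$ -/

import Mathlib

/-- The Euclidean plane. -/
abbrev Plane : Type := EuclideanSpace ℝ (Fin 2)

/-- A circle in the plane; radius `0` is allowed, in which case the circle is a point. -/
structure PlaneCircle where
  center : Plane
  radius : ℝ
  radius_nonneg : 0 ≤ radius

namespace PlaneCircle

/-- The closed set of points belonging to a circle (the closed disk). -/
def disk (x : PlaneCircle) : Set Plane := Metric.closedBall x.center x.radius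

/-- The boundary `Circ(x)` of a circle. -/
def circ (x : PlaneCircle) : Set Plane := Metric.sphere x.center x.radius

/-- The point of `Circ(x)` at the angle `θ`, measured counterclockwise. -/
noncomputable def pointAt (x : PlaneCircle) (θ : ℝ) : Plane :=
  x.center + x.radius • !₂[Real.cos θ, Real.sin θ]

/-- The ray that starts at the centre of `u` and goes through the centre of `x`. -/
def rayTo (u x : PlaneCircle) : Set Plane :=
  {p | ∃ t : ℝ, 0 ≤ t ∧ p = u.center + t • (x.center - u.center)}

/-- The points at which the outer common tangent lines of `u` and `x` touch `Circ(u)`.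
Such a line `{z | ⟪n, z⟫ = k}` has both disks on the same side and meets both of them. -/
def touchingPoints (u x : PlaneCircle) : Set Plane :=
  {p | p ∈ u.circ ∧ ∃ (n : Plane) (k : ℝ), ‖n‖ = 1 ∧ inner ℝ n p = k ∧
    (∀ z ∈ u.disk, inner ℝ n z ≤ k) ∧ (∀ z ∈ x.disk, inner ℝ n z ≤ k) ∧
    ∃ q ∈ x.disk, inner ℝ n q = k}

/-- Walking counterclockwise along `Circ(u)`, starting at the first of the points `p`, one meets
the points `p` in the listed order before the first turn is completed (consecutive points may
coincide). -/
def CcwOrder (u : PlaneCircle) {n : ℕ} (p : Fin n → Plane) : Prop :=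
  ∃ θ : Fin n → ℝ, Monotone θ ∧ (∀ i j, θ j < θ i + 2 * Real.pi) ∧ ∀ i, p i = u.pointAt (θ i)

/-- The convex hull operator for circles on a finite set `X` of circles. -/
def chc (X : Finset PlaneCircle) : ClosureOperator (Set X) where
  toFun Y := {x | x.1.disk ⊆ convexHull ℝ (⋃ y ∈ Y, y.1.disk)}
  monotone' := fun _ _ h _ hx =>
    hx.trans (convexHull_mono (Set.biUnion_subset_biUnion_left h))
  le_closure' := fun Y _ hx =>
    (Set.subset_biUnion_of_mem (u := fun y : X => y.1.disk) hx).trans (subset_convexHull ℝ _)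
  idempotent' := fun Y => by
    apply Set.Subset.antisymm
    · intro x hx
      exact Set.Subset.trans hx (convexHull_min (Set.iUnion₂_subset fun y hy => hy)
        (convex_convexHull ℝ _))
    · intro x hx
      exact (Set.subset_biUnion_of_mem (u := fun y : X => y.1.disk) hx).trans
        (subset_convexHull ℝ _)

end PlaneCircle

/-- The implication `Y → u` holds in the closure system `(α, φ)`. -/
def Implication {α : Type*} (φ : ClosureOperator (Set α)) (Y : Set α) (u : α) : Prop :=
  u ∈ φ Y

/-- The implication `Y → u` holds and is tight. -/
def TightImplication {α : Type*} (φ : ClosureOperator (Set α)) (Y : Set α) (u : α) : Prop :=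
  Implication φ Y u ∧ ∀ z ∈ Y, ¬ Implication φ (Y \ {z}) u

open Real

/-! Compare support functions. A disk lies in the hull of finitely many disks iff in every direction
one of them reaches as far as it does. If `d` has positive radius, the directions in which `x`
reaches as far as `d` form an arc centred at the ray direction and ending at the two touching points
(`exists_angularArc_of_touchingPoints`). A tight implication thus says that three arcs cover the
circle while no two do. In such a covering, cyclically neighbouring arcs must meet
(`angularArc_overlap`), and, as two arcs leave a gap, they cannot also meet on the far side
(`angularArc_gap`). These six inequalities, collected in `angularArc_endpoint_order`, are the
claimed order. -/

/-! ### Compactness of hulls. -/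

theorem IsCompact.convexHull_union {E : Type*} [AddCommGroup E] [Module ℝ E] [TopologicalSpace E]
    [ContinuousAdd E] [ContinuousSMul ℝ E] {s t : Set E} (hs : IsCompact s) (ht : IsCompact t)
    (hsc : Convex ℝ s) (htc : Convex ℝ t) : IsCompact (convexHull ℝ (s ∪ t)) := by
  rcases s.eq_empty_or_nonempty with rfl | hsne
  · rwa [Set.empty_union, htc.convexHull_eq]
  rcases t.eq_empty_or_nonempty with rfl | htne
  · rwa [Set.union_empty, hsc.convexHull_eq]
  have himage : convexJoin ℝ s t =
      (fun x : ℝ × E × E => (1 - x.1) • x.2.1 + x.1 • x.2.2) '' (Set.Icc 0 1 ×ˢ s ×ˢ t) := by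
    ext z
    simp only [mem_convexJoin, segment_eq_image, Set.mem_image, Set.mem_prod, Prod.exists]
    constructor
    · rintro ⟨x, hx, y, hy, r, hr, rfl⟩
      exact ⟨r, x, y, ⟨hr, hx, hy⟩, rfl⟩
    · rintro ⟨r, x, y, ⟨hr, hx, hy⟩, rfl⟩
      exact ⟨x, hx, y, hy, r, hr, rfl⟩
  rw [hsc.convexHull_union htc hsne htne, himage]
  exact (isCompact_Icc.prod (hs.prod ht)).image (by fun_prop)

/-- Makes the hull of the disks closed, so that a point outside it can be strictly separated. -/
theorem Set.Finite.isCompact_convexHull_biUnion {ι E : Type*} [AddCommGroup E] [Module ℝ E]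
    [TopologicalSpace E] [ContinuousAdd E] [ContinuousSMul ℝ E] {s : Set ι} (hs : s.Finite)
    {f : ι → Set E} (hf : ∀ i ∈ s, IsCompact (f i)) (hfc : ∀ i ∈ s, Convex ℝ (f i)) :
    IsCompact (convexHull ℝ (⋃ i ∈ s, f i)) := by
  induction s, hs using Set.Finite.induction_on with
  | empty => simp
  | insert _ _ ih =>
    rw [Set.biUnion_insert, ← convexHull_convexHull_union_right]
    exact (hf _ (Set.mem_insert _ _)).convexHull_union
      (ih (fun i hi => hf i (Set.mem_insert_of_mem _ hi))
        fun i hi => hfc i (Set.mem_insert_of_mem _ hi))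
      (hfc _ (Set.mem_insert _ _)) (convex_convexHull ℝ _)

/-! ### Coverings of the circle by arcs. -/

/-- The closed arc of angles at distance at most `w` from `m`, modulo full turns. -/
def angularArc (m w : ℝ) : Set ℝ := {θ | ∃ k : ℤ, |θ - m - k * (2 * π)| ≤ w}

theorem cos_le_cos_iff_mem_angularArc {m w θ : ℝ} (hw₀ : 0 ≤ w) (hw : w ≤ π) :
    cos w ≤ cos (θ - m) ↔ θ ∈ angularArc m w := by
  constructor
  · intro h
    refine ⟨round ((θ - m) / (2 * π)), ?_⟩
    set k := round ((θ - m) / (2 * π)) with hk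
    have hpos : 0 < 2 * π := two_pi_pos
    have h1 : |(θ - m) / (2 * π) - k| ≤ 1 / 2 := abs_sub_round _
    have h2 : |θ - m - k * (2 * π)| ≤ π := by
      have : θ - m - k * (2 * π) = ((θ - m) / (2 * π) - k) * (2 * π) := by field_simp
      rw [this, abs_mul, abs_of_pos hpos]
      nlinarith
    rw [← cos_sub_int_mul_two_pi (θ - m) k, ← cos_abs (θ - m - k * (2 * π))] at h
    exact (strictAntiOn_cos.le_iff_ge ⟨hw₀, hw⟩ ⟨abs_nonneg _, h2⟩).1 h
  · rintro ⟨k, hk⟩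
    rw [← cos_sub_int_mul_two_pi (θ - m) k, ← cos_abs (θ - m - k * (2 * π))]
    exact cos_le_cos_of_nonneg_of_le_pi (abs_nonneg _) hw hk

theorem angularArc_subset_angularArc {m w m' w' : ℝ} (k : ℤ)
    (h₁ : m' + k * (2 * π) - w' ≤ m - w) (h₂ : m + w ≤ m' + k * (2 * π) + w') :
    angularArc m w ⊆ angularArc m' w' := by
  rintro θ ⟨l, hl⟩
  refine ⟨k + l, ?_⟩
  rw [abs_le] at hl ⊢
  push_cast
  constructor <;> linarith [hl.1, hl.2]

theorem angularArc_add_two_pi (m w : ℝ) : angularArc (m + 2 * π) w = angularArc m w := by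
  apply Set.Subset.antisymm
  · exact angularArc_subset_angularArc 1 (by push_cast; linarith) (by push_cast; linarith)
  · exact angularArc_subset_angularArc (-1) (by push_cast; linarith) (by push_cast; linarith)

/-- If two arcs, on one side of which lies the midpoint of a third arc, form with it a covering of
the circle that cannot be reduced, then they meet on the other side. -/
theorem angularArc_overlap {p q s u v w : ℝ} (hpq : p ≤ q) (hqs : q ≤ s) (hsp : s ≤ p + 2 * π)
    (hu : u < π) (hv : v < π)
    (hcov : ∀ θ, θ ∈ angularArc p u ∨ θ ∈ angularArc q v ∨ θ ∈ angularArc s w)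
    (hp : ¬ angularArc p u ⊆ angularArc s w) (hq : ¬ angularArc q v ⊆ angularArc s w) :
    q - v ≤ p + u := by
  by_contra! hlt
  -- A direction in the supposed gap; the other two bounds keep it off the neighbouring translates
  -- of the first two arcs.
  obtain ⟨θ, hθ₁, hθ₂⟩ : ∃ θ, max (p + u) (q - 2 * π + v) < θ ∧
      θ < min (q - v) (p + 2 * π - u) := by
    apply exists_between
    rw [max_lt_iff, lt_min_iff, lt_min_iff]
    refine ⟨⟨hlt, ?_⟩, ?_, ?_⟩ <;> linarith
  rw [max_lt_iff] at hθ₁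
  rw [lt_min_iff] at hθ₂
  have hpi := two_pi_pos
  have key : ∀ k : ℤ, (k : ℝ) * (2 * π) ≤ -(2 * π) ∨ 0 ≤ (k : ℝ) * (2 * π) := by
    intro k
    rcases lt_or_ge k 0 with hk | hk
    · left
      have : (k : ℝ) ≤ -1 := by exact_mod_cast Int.le_sub_one_of_lt hk
      nlinarith
    · right
      have : (0 : ℝ) ≤ k := by exact_mod_cast hk
      positivity
  have key' : ∀ k : ℤ, (k : ℝ) * (2 * π) ≤ 0 ∨ 2 * π ≤ (k : ℝ) * (2 * π) := by
    intro k
    rcases key (-k) with h | h <;> push_cast at h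
    · right; linarith
    · left; linarith
  rcases hcov θ with ⟨k, hk⟩ | ⟨k, hk⟩ | ⟨k, hk⟩ <;> rw [abs_le] at hk
  · rcases key' k with h | h <;> linarith [hk.1, hk.2, hθ₁.1, hθ₁.2, hθ₂.1, hθ₂.2]
  · rcases key k with h | h <;> linarith [hk.1, hk.2, hθ₁.1, hθ₁.2, hθ₂.1, hθ₂.2]
  -- The copy of the third arc through `θ` is centred at or before `p`, or at or after `q`; to reach
  -- `θ` it must swallow the first or the second arc.
  · rcases key k with h | h
    · exact hp (angularArc_subset_angularArc k (by linarith [hk.1, hk.2, hθ₁.1])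
        (by linarith [hk.1, hk.2, hθ₁.1]))
    · exact hq (angularArc_subset_angularArc k (by linarith [hk.1, hk.2, hθ₂.1])
        (by linarith [hk.1, hk.2, hθ₂.1]))

/-- Two arcs that meet on one side and do not cover the circle are disjoint on the other side. -/
theorem angularArc_gap {p q u v : ℝ} (hover : q - v ≤ p + u)
    (hcov : ∃ θ, θ ∉ angularArc p u ∧ θ ∉ angularArc q v) :
    q + v < p - u + 2 * π := by
  by_contra! hle
  obtain ⟨θ, hp, hq⟩ := hcov
  -- The turn starting at `p - u` would be filled by the two arcs.
  obtain ⟨k, hk, -⟩ := existsUnique_sub_zsmul_mem_Ico two_pi_pos θ (p - u)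
  rw [zsmul_eq_mul, Set.mem_Ico] at hk
  rcases le_total (θ - k * (2 * π)) (p + u) with h | h
  · exact hp ⟨k, by rw [abs_le]; constructor <;> linarith [hk.1]⟩
  · exact hq ⟨k, by rw [abs_le]; constructor <;> linarith [hk.2]⟩

/-- The order of the endpoints of three arcs that form a covering of the circle of which no two
arcs suffice, given the order `p`, `q`, `s` of the midpoints. -/
theorem angularArc_endpoint_order {p q s u v w : ℝ}
    (hpq : p ≤ q) (hqs : q ≤ s) (hsp : s ≤ p + 2 * π)
    (hu : u < π) (hv : v < π) (hw : w < π)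
    (hcov : ∀ θ, θ ∈ angularArc p u ∨ θ ∈ angularArc q v ∨ θ ∈ angularArc s w)
    (hpq' : ∃ θ, θ ∉ angularArc p u ∧ θ ∉ angularArc q v)
    (hqs' : ∃ θ, θ ∉ angularArc q v ∧ θ ∉ angularArc s w)
    (hsp' : ∃ θ, θ ∉ angularArc s w ∧ θ ∉ angularArc p u) :
    (p - u ≤ s + w - 2 * π ∧ q - v ≤ p + u ∧ s - w ≤ q + v) ∧
      s + w - 2 * π < q - v ∧ p + u < s - w ∧ q + v < p - u + 2 * π := by
  have nsub : ∀ {A B C : Set ℝ}, (∀ θ, θ ∈ A ∨ θ ∈ B ∨ θ ∈ C) → (∃ θ, θ ∉ B ∧ θ ∉ C) →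
      ¬ A ⊆ B ∧ ¬ A ⊆ C := by
    rintro A B C h ⟨θ, hB, hC⟩
    have hA : θ ∈ A := (h θ).resolve_right (not_or.2 ⟨hB, hC⟩)
    exact ⟨fun H => hB (H hA), fun H => hC (H hA)⟩
  have np := nsub hcov hqs'
  have nq := nsub (A := angularArc q v) (B := angularArc s w) (C := angularArc p u)
    (fun θ => by have := hcov θ; tauto) hsp'
  have ns := nsub (A := angularArc s w) (B := angularArc p u) (C := angularArc q v)
    (fun θ => by have := hcov θ; tauto) hpq'
  have h₁ := angularArc_overlap hpq hqs hsp hu hv hcov np.2 nq.1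
  -- Cyclic rotation: a midpoint that has been passed reappears one turn later.
  have h₂ := angularArc_overlap (w := u) hqs hsp (by linarith) hv hw
    (fun θ => by have := hcov θ; rw [angularArc_add_two_pi]; tauto)
    (by rw [angularArc_add_two_pi]; exact nq.2) (by rw [angularArc_add_two_pi]; exact ns.1)
  have h₃ := angularArc_overlap (p := s) (q := p + 2 * π) (s := q + 2 * π) (w := v) hsp
    (by linarith) (by linarith) hw hu
    (fun θ => by have := hcov θ; rw [angularArc_add_two_pi, angularArc_add_two_pi]; tauto)
    (by rw [angularArc_add_two_pi]; exact ns.2)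
    (by rw [angularArc_add_two_pi, angularArc_add_two_pi]; exact np.1)
  have g₁ := angularArc_gap h₁ hpq'
  have g₂ := angularArc_gap h₂ hqs'
  have g₃ := angularArc_gap h₃ (by rw [angularArc_add_two_pi]; exact hsp')
  refine ⟨⟨?_, ?_, ?_⟩, ?_, ?_, ?_⟩ <;> linarith

/-! ### Unit vectors and angles. -/

/-- The unit vector in the direction `θ`. -/
noncomputable def unitAt (θ : ℝ) : Plane := !₂[cos θ, sin θ]

theorem inner_unitAt (θ φ : ℝ) : inner ℝ (unitAt θ) (unitAt φ) = cos (θ - φ) := by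
  simp [unitAt, PiLp.inner_apply, Fin.sum_univ_two, cos_sub]
  ring

theorem norm_unitAt (θ : ℝ) : ‖unitAt θ‖ = 1 := by
  have h := inner_unitAt θ θ
  rw [real_inner_self_eq_norm_sq, sub_self, cos_zero] at h
  exact (pow_eq_one_iff_of_nonneg (norm_nonneg _) two_ne_zero).1 h

theorem exists_eq_norm_smul_unitAt (n : Plane) : ∃ θ, n = ‖n‖ • unitAt θ := by
  set z : ℂ := ⟨n 0, n 1⟩ with hz
  have hn : ‖z‖ = ‖n‖ := by
    rw [EuclideanSpace.norm_eq, Fin.sum_univ_two, Complex.norm_eq_sqrt_sq_add_sq]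
    simp [hz]
  refine ⟨z.arg, ?_⟩
  ext i
  fin_cases i
  · simpa [unitAt, hn] using (Complex.norm_mul_cos_arg z).symm
  · simpa [unitAt, hn] using (Complex.norm_mul_sin_arg z).symm

theorem unitAt_eq_iff {θ φ : ℝ} : unitAt θ = unitAt φ ↔ ∃ k : ℤ, θ = φ + k * (2 * π) := by
  constructor
  · intro h
    have h0 : cos θ = cos φ := by simpa [unitAt] using congrArg (fun v : Plane => v 0) h
    have h1 : sin θ = sin φ := by simpa [unitAt] using congrArg (fun v : Plane => v 1) h
    obtain ⟨k, hk⟩ := Real.Angle.angle_eq_iff_two_pi_dvd_sub.1 (Real.Angle.cos_sin_inj h0 h1)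
    exact ⟨k, by linarith⟩
  · rintro ⟨k, rfl⟩
    simp [unitAt]

/-! ### Support functions and tangent lines. -/

namespace PlaneCircle

theorem pointAt_eq (x : PlaneCircle) (θ : ℝ) :
    x.pointAt θ = x.center + x.radius • unitAt θ := rfl

theorem pointAt_add_int_mul_two_pi (x : PlaneCircle) (θ : ℝ) (k : ℤ) :
    x.pointAt (θ + k * (2 * π)) = x.pointAt θ := by
  rw [pointAt_eq, pointAt_eq, unitAt_eq_iff.2 ⟨k, rfl⟩]

theorem pointAt_sub_two_pi (x : PlaneCircle) (θ : ℝ) : x.pointAt (θ - 2 * π) = x.pointAt θ := by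
  rw [← pointAt_add_int_mul_two_pi x θ (-1)]
  congr 1
  push_cast
  ring

theorem pointAt_eq_iff {x : PlaneCircle} (hx : 0 < x.radius) {θ φ : ℝ} :
    x.pointAt θ = x.pointAt φ ↔ ∃ k : ℤ, θ = φ + k * (2 * π) := by
  rw [pointAt_eq, pointAt_eq, add_right_inj, smul_right_inj hx.ne', unitAt_eq_iff]

theorem inner_le_of_mem_disk {x : PlaneCircle} {n z : Plane} (hn : ‖n‖ = 1) (hz : z ∈ x.disk) :
    inner ℝ n z ≤ inner ℝ n x.center + x.radius := by
  have h := real_inner_le_norm n (z - x.center)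
  rw [hn, one_mul, inner_sub_right] at h
  have hz' : ‖z - x.center‖ ≤ x.radius := by rwa [← dist_eq_norm]
  linarith

theorem add_smul_mem_disk (x : PlaneCircle) {n : Plane} (hn : ‖n‖ = 1) :
    x.center + x.radius • n ∈ x.disk := by
  simp [disk, norm_smul, hn, abs_of_nonneg x.radius_nonneg]

theorem inner_add_smul (x : PlaneCircle) {n : Plane} (hn : ‖n‖ = 1) :
    inner ℝ n (x.center + x.radius • n) = inner ℝ n x.center + x.radius := by
  rw [inner_add_right, inner_smul_right, real_inner_self_eq_norm_sq, hn]
  ring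

/-- A line supporting `u` at a boundary point has the radial direction as its normal; it also
supports `x`, so the two support values agree. -/
theorem inner_unitAt_eq_of_pointAt_mem_touchingPoints {u x : PlaneCircle} (hu : 0 < u.radius)
    {φ : ℝ} (h : u.pointAt φ ∈ u.touchingPoints x) :
    inner ℝ (unitAt φ) (x.center - u.center) = u.radius - x.radius := by
  obtain ⟨-, n, k, hn, hk, hu', hx, q, hq, hqk⟩ := h
  have h₁ := hu' _ (u.add_smul_mem_disk hn)
  rw [u.inner_add_smul hn] at h₁
  have h₂ := hx _ (x.add_smul_mem_disk hn)
  rw [x.inner_add_smul hn] at h₂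
  have h₃ := inner_le_of_mem_disk hn hq
  rw [pointAt_eq, inner_add_right, inner_smul_right] at hk
  have h₄ : inner ℝ n (unitAt φ) ≤ 1 := by
    simpa [hn, norm_unitAt] using real_inner_le_norm n (unitAt φ)
  have h₅ : inner ℝ n (unitAt φ) = 1 := by
    apply le_antisymm h₄
    nlinarith
  have h₆ := (inner_eq_one_iff_of_norm_eq_one hn (norm_unitAt φ)).1 h₅
  rw [h₅] at hk
  rw [← h₆, inner_sub_right]
  linarith

/-- The touching points of the outer common tangent lines lie symmetrically around the point on the
ray, and they bound the arc of the directions in which `x` reaches as far as `u`. -/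
theorem exists_angularArc_of_touchingPoints {u x : PlaneCircle} (hu : 0 < u.radius)
    {α : ℝ} {P₁ P₂ : Plane} (h₀ : u.pointAt α ∈ u.rayTo x)
    (h₁ : P₁ ∈ u.touchingPoints x) (h₂ : P₂ ∈ u.touchingPoints x)
    (h : u.CcwOrder ![P₁, u.pointAt α, P₂]) :
    ∃ w, w < π ∧ P₁ = u.pointAt (α - w) ∧ P₂ = u.pointAt (α + w) ∧
      ∀ θ, θ ∈ angularArc α w ↔
        inner ℝ (unitAt θ) u.center + u.radius ≤ inner ℝ (unitAt θ) x.center + x.radius := by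
  obtain ⟨t, ht, hray⟩ := h₀
  rw [pointAt_eq, add_right_inj] at hray
  have ht' : 0 < t := by
    refine lt_of_le_of_ne ht ?_
    rintro rfl
    have := congrArg norm hray
    rw [norm_smul, norm_unitAt, zero_smul, norm_zero, mul_one, norm_eq_abs,
      abs_of_pos hu] at this
    exact hu.ne' this
  have hR : 0 < u.radius / t := div_pos hu ht'
  set R := u.radius / t with hRdef
  have hx : x.center - u.center = R • unitAt α := by
    rw [hRdef, div_eq_inv_mul, mul_smul, hray, smul_smul, inv_mul_cancel₀ ht'.ne', one_smul]
  have hinner : ∀ θ, inner ℝ (unitAt θ) (x.center - u.center) = R * cos (θ - α) := by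
    intro θ
    rw [hx, inner_smul_right, inner_unitAt]
  obtain ⟨φ, hmono, hlt, hφ⟩ := h
  have e₁ : P₁ = u.pointAt (φ 0) := hφ 0
  have e₀ : u.pointAt α = u.pointAt (φ 1) := hφ 1
  have e₂ : P₂ = u.pointAt (φ 2) := hφ 2
  have l₁ : φ 0 ≤ φ 1 := hmono (by decide)
  have l₂ : φ 1 ≤ φ 2 := hmono (by decide)
  have l₃ : φ 2 < φ 0 + 2 * π := hlt 0 2
  obtain ⟨k, hk⟩ := (pointAt_eq_iff hu).1 e₀
  have c₁ := inner_unitAt_eq_of_pointAt_mem_touchingPoints hu (e₁ ▸ h₁)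
  have c₂ := inner_unitAt_eq_of_pointAt_mem_touchingPoints hu (e₂ ▸ h₂)
  rw [hinner] at c₁ c₂
  have c₁' : R * cos (φ 1 - φ 0) = u.radius - x.radius := by
    rw [← c₁, ← cos_neg, ← cos_sub_int_mul_two_pi (φ 0 - α) (-k)]
    congr 2
    rw [hk]
    push_cast
    ring
  have c₂' : R * cos (φ 2 - φ 1) = u.radius - x.radius := by
    rw [← c₂, ← cos_sub_int_mul_two_pi (φ 2 - α) (-k)]
    congr 2
    rw [hk]
    push_cast
    ring
  have hcos : cos (φ 1 - φ 0) = cos (φ 2 - φ 1) :=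
    mul_left_cancel₀ hR.ne' (c₁'.trans c₂'.symm)
  -- Equal cosines leave equality or opposite signs modulo `2 * π`; both gaps are nonnegative with
  -- sum below `2 * π`, so in the second case both vanish.
  have hw : φ 2 - φ 1 = φ 1 - φ 0 := by
    have hpi := two_pi_pos
    obtain ⟨l, hl | hl⟩ := cos_eq_cos_iff.1 hcos
    · have a₁ : (l : ℝ) < 1 := by nlinarith
      have a₂ : (-1 : ℝ) < l := by nlinarith
      have : l = 0 := by
        have a₁' : l < 1 := by exact_mod_cast a₁
        have a₂' : -1 < l := by exact_mod_cast a₂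
        omega
      subst this
      push_cast at hl
      linarith
    · have a₁ : (l : ℝ) < 1 := by nlinarith
      have a₁' : l < 1 := by exact_mod_cast a₁
      have a₂ : (l : ℝ) ≤ 0 := by exact_mod_cast Int.lt_add_one_iff.1 a₁'
      nlinarith
  have hwpi : φ 1 - φ 0 < π := by linarith
  refine ⟨φ 1 - φ 0, hwpi, ?_, ?_, fun θ => ?_⟩
  · rw [e₁, pointAt_eq_iff hu]
    exact ⟨-k, by rw [hk]; push_cast; ring⟩
  · rw [e₂, pointAt_eq_iff hu]
    exact ⟨-k, by rw [← hw, hk]; push_cast; ring⟩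
  · rw [← cos_le_cos_iff_mem_angularArc (by linarith) hwpi.le, ← mul_le_mul_iff_right₀ hR, c₁',
      ← hinner θ, inner_sub_right]
    constructor <;> intro h <;> linarith

/-- If a circle is contained in the convex hull of some circles, then in each direction one of
these reaches as far. -/
theorem exists_inner_le_of_disk_subset_convexHull {s : Set PlaneCircle} {u : PlaneCircle}
    (h : u.disk ⊆ convexHull ℝ (⋃ y ∈ s, y.disk)) {n : Plane} (hn : ‖n‖ = 1) :
    ∃ y ∈ s, inner ℝ n u.center + u.radius ≤ inner ℝ n y.center + y.radius := by
  by_contra! hlt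
  have hsub : convexHull ℝ (⋃ y ∈ s, y.disk) ⊆
      {z | inner ℝ n z < inner ℝ n u.center + u.radius} := by
    refine convexHull_min ?_ (convex_halfSpace_lt ⟨fun _ _ => inner_add_right _ _ _,
      fun _ _ => inner_smul_right _ _ _⟩ _)
    exact Set.iUnion₂_subset fun y hy z hz => (inner_le_of_mem_disk hn hz).trans_lt (hlt y hy)
  have := hsub (h (u.add_smul_mem_disk hn))
  rw [Set.mem_ofPred_eq, u.inner_add_smul hn] at this
  exact lt_irrefl _ this

/-- If a circle is not contained in the convex hull of some circles, then in some direction it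
reaches farther than each of these. -/
theorem exists_inner_lt_of_not_disk_subset_convexHull {s : Set PlaneCircle} {u : PlaneCircle}
    (hs : s.Finite) (h : ¬ u.disk ⊆ convexHull ℝ (⋃ y ∈ s, y.disk)) :
    ∃ θ, ∀ y ∈ s, inner ℝ (unitAt θ) y.center + y.radius <
      inner ℝ (unitAt θ) u.center + u.radius := by
  obtain ⟨p, hp, hps⟩ := Set.not_subset.1 h
  have hcpt : IsCompact (convexHull ℝ (⋃ y ∈ s, y.disk)) :=
    hs.isCompact_convexHull_biUnion (fun y _ => isCompact_closedBall _ _)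
      fun y _ => convex_closedBall _ _
  obtain ⟨f, c, hf, hc⟩ :=
    geometric_hahn_banach_closed_point (convex_convexHull ℝ _) hcpt.isClosed hps
  set m := (InnerProductSpace.toDual ℝ Plane).symm f with hm
  have hfm : ∀ z, f z = inner ℝ m z := fun z => by
    rw [hm, InnerProductSpace.toDual_symm_apply]
  obtain ⟨θ, hθ⟩ := exists_eq_norm_smul_unitAt m
  have hlt : ∀ y ∈ s, ∀ z ∈ y.disk, ‖m‖ * inner ℝ (unitAt θ) z < ‖m‖ * inner ℝ (unitAt θ) p := by
    intro y hy z hz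
    have h₁ := (hf z (subset_convexHull ℝ _ (Set.mem_biUnion hy hz))).trans hc
    rwa [hfm, hfm, hθ, real_inner_smul_left, real_inner_smul_left] at h₁
  refine ⟨θ, fun y hy => ?_⟩
  -- Cancelling needs only `0 ≤ ‖m‖`, so empty `s`, where `m` may vanish, is no exception.
  have h₂ := lt_of_mul_lt_mul_left (hlt y hy _ (y.add_smul_mem_disk (norm_unitAt θ)))
    (norm_nonneg m)
  rw [y.inner_add_smul (norm_unitAt θ)] at h₂
  exact h₂.trans_le (inner_le_of_mem_disk (norm_unitAt θ) hp)

theorem implication_chc_iff {X : Finset PlaneCircle} {Y : Set X} {u : X} :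
    Implication (chc X) Y u ↔
      u.1.disk ⊆ convexHull ℝ (⋃ y ∈ ((↑) '' Y : Set PlaneCircle), y.disk) := by
  rw [Set.biUnion_image]
  rfl

theorem ccwOrder_of_radius_eq_zero {u : PlaneCircle} (hu : u.radius = 0) {n : ℕ}
    {p : Fin n → Plane} (hp : ∀ i, p i ∈ u.circ) : u.CcwOrder p := by
  refine ⟨fun _ => 0, monotone_const, fun _ _ => by linarith [two_pi_pos], fun i => ?_⟩
  have h := hp i
  rw [circ, hu, Metric.sphere_zero, Set.mem_singleton_iff] at h
  rw [h, pointAt_eq, hu, zero_smul, add_zero]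

end PlaneCircle

/-! ### The Point Order Theorem. -/

theorem theorem4p2 (X : Finset PlaneCircle) (a b c d : X)
    (hab : a ≠ b) (hac : a ≠ c) (hbc : b ≠ c)
    (htight : TightImplication (PlaneCircle.chc X) {a, b, c} d)
    (A₀ A₁ A₂ B₀ B₁ B₂ C₀ C₁ C₂ : Plane)
    (hA₀ : A₀ ∈ d.1.rayTo a ∩ d.1.circ)
    (hB₀ : B₀ ∈ d.1.rayTo b ∩ d.1.circ)
    (hC₀ : C₀ ∈ d.1.rayTo c ∩ d.1.circ)
    (h₀ : d.1.CcwOrder ![B₀, A₀, C₀])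
    (hA₁ : A₁ ∈ d.1.touchingPoints a) (hA₂ : A₂ ∈ d.1.touchingPoints a)
    (hB₁ : B₁ ∈ d.1.touchingPoints b) (hB₂ : B₂ ∈ d.1.touchingPoints b)
    (hC₁ : C₁ ∈ d.1.touchingPoints c) (hC₂ : C₂ ∈ d.1.touchingPoints c)
    (hA : d.1.CcwOrder ![A₁, A₀, A₂])
    (hB : d.1.CcwOrder ![B₁, B₀, B₂])
    (hC : d.1.CcwOrder ![C₂, C₀, C₁]) :
    d.1.CcwOrder ![B₁, C₁, A₁, B₂, C₂, A₂] := by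
  -- For radius `0` all points coincide and angles are not determined by points.
  rcases d.1.radius_nonneg.eq_or_lt with hr | hr
  · refine PlaneCircle.ccwOrder_of_radius_eq_zero hr.symm fun i => ?_
    fin_cases i
    exacts [hB₁.1, hC₁.1, hA₁.1, hB₂.1, hC₂.1, hA₂.1]
  obtain ⟨φ, hmono, hlt, hφ⟩ := h₀
  obtain rfl : B₀ = d.1.pointAt (φ 0) := hφ 0
  obtain rfl : A₀ = d.1.pointAt (φ 1) := hφ 1
  obtain rfl : C₀ = d.1.pointAt (φ 2) := hφ 2
  obtain ⟨v, hv, rfl, rfl, hva⟩ :=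
    PlaneCircle.exists_angularArc_of_touchingPoints hr hA₀.1 hA₁ hA₂ hA
  obtain ⟨u, hu, rfl, rfl, hub⟩ :=
    PlaneCircle.exists_angularArc_of_touchingPoints hr hB₀.1 hB₁ hB₂ hB
  obtain ⟨w, hw, rfl, rfl, hwc⟩ :=
    PlaneCircle.exists_angularArc_of_touchingPoints hr hC₀.1 hC₂ hC₁ hC
  have hcov : ∀ θ, θ ∈ angularArc (φ 0) u ∨ θ ∈ angularArc (φ 1) v ∨ θ ∈ angularArc (φ 2) w := by
    intro θ
    obtain ⟨_, ⟨y, hy, rfl⟩, h⟩ := PlaneCircle.exists_inner_le_of_disk_subset_convexHull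
      (PlaneCircle.implication_chc_iff.1 htight.1) (norm_unitAt θ)
    rw [hub, hva, hwc]
    rcases hy with rfl | rfl | rfl
    exacts [Or.inr (Or.inl h), Or.inl h, Or.inr (Or.inr h)]
  have hpair : ∀ x y z : X, x ∈ ({a, b, c} : Set X) → y ∈ ({a, b, c} : Set X) \ {x} →
      z ∈ ({a, b, c} : Set X) \ {x} → ∃ θ,
        inner ℝ (unitAt θ) y.1.center + y.1.radius <
          inner ℝ (unitAt θ) d.1.center + d.1.radius ∧
        inner ℝ (unitAt θ) z.1.center + z.1.radius <
          inner ℝ (unitAt θ) d.1.center + d.1.radius := by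
    intro x y z hx hy hz
    obtain ⟨θ, hθ⟩ := PlaneCircle.exists_inner_lt_of_not_disk_subset_convexHull
      (Set.toFinite _) (mt PlaneCircle.implication_chc_iff.2 (htight.2 x hx))
    exact ⟨θ, hθ _ ⟨y, hy, rfl⟩, hθ _ ⟨z, hz, rfl⟩⟩
  obtain ⟨⟨i₁, i₂, i₃⟩, j₁, j₂, j₃⟩ := angularArc_endpoint_order
    (hmono (by decide : (0 : Fin 3) ≤ 1)) (hmono (by decide : (1 : Fin 3) ≤ 2)) (hlt 0 2).le
    hu hv hw hcov
    (by simpa only [hub, hva, not_le] using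
      hpair c b a (by simp) (by simp [hbc]) (by simp [hac]))
    (by simpa only [hwc, hva, not_le] using
      hpair b a c (by simp) (by simp [hab]) (by simp [hbc.symm]))
    (by simpa only [hub, hwc, not_le] using
      hpair a c b (by simp) (by simp [hac.symm]) (by simp [hab.symm]))
  -- `C₁` is the far end of its arc, hence is lifted one turn back.
  have hstep : Monotone ![φ 0 - u, φ 2 + w - 2 * π, φ 1 - v, φ 0 + u, φ 2 - w, φ 1 + v] := by
    rw [Fin.monotone_iff_le_succ]
    intro i
    fin_cases i
    exacts [i₁, j₁.le, i₂, j₂.le, i₃]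
  refine ⟨_, hstep, fun i j => ?_, fun i => ?_⟩
  · have h₁ := hstep (Fin.zero_le i)
    have h₂ := hstep (Fin.le_last j)
    refine h₂.trans_lt (lt_of_lt_of_le ?_ (add_le_add_left h₁ _))
    exact j₃.trans_eq rfl
  · fin_cases i
    exacts [rfl, (PlaneCircle.pointAt_sub_two_pi _ _).symm, rfl, rfl, rfl, rfl]
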